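/- Let $n\ge 1$ be odd, let $b_1,\dots,b_n\in\{1,-1\}$, $J=\mathrm{diag}(b_1,\dots,b_n)$ and $F(x)=x^tJx=\sum_i b_ix_i^2$. For $c\in\mathbb Z^n$, $q\ge 1$ and a prime $p$ put $$S(q,c)=\sum_{a \bmod q}\ \sum_{x\in(\mathbb Z/q\mathbb Z)^n} e^{2\pi i\,(aF(x)+c\cdot x)/q},\qquad D(c,s)=\sum_{q=1}^{\infty}\frac{S(q,c)}{q^{s+n+1}},\qquad D_p(c,s)=\sum_{k=0}^{\infty}\frac{S(p^k,c)}{p^{k(s+n+1)}} .$$ Write $s=\sigma+it$. Let $m=\#\{i: b_i=1\}$, and let $d=2^{(n-1)/2}$ if $2m-n\equiv 1,7 \pmod 8$ and $d=-2^{(n-1)/2}$ if $2m-n\equiv 3,5\pmod 8$. **Theorem 4.1.** The series $D(0,s)$ and $D_2(0,s)$ converge absolutely for $\sigma>1$, and there $$D(0,s)=D_2(0,s)\,\frac{(1-2^{-(s+1)})(1-2^{-(2s+n)})}{1-2^{-(2s+n+1)}}\cdot\frac{\zeta(s+1)\,\zeta(2s+n)}{\zeta(2s+n+1)} .$$ Both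 $D(0,s)$ and $D_2(0,s)$ extend to meromorphic functions on $\mathbb C$, and the same identity holds between the extensions, as an identity of meromorphic functions. Moreover, on the half plane $\sigma>-n/2$ the function $D_2(0,s)\,\frac{(1-2^{-(s+1)})(1-2^{-(2s+n)})}{1-2^{-(2s+n+1)}}$ is holomorphic (after removing removable singularities), it is given there by $$\frac{1-2^{-(2s+n)}+d\,2^{-(2s+n+1)}}{1-2^{-(2s+n+1)}},$$ and for every $\epsilon>0$ its absolute value is bounded on $\sigma\ge -n/2+\epsilon$ by a constant that depends only on $n$ and $\epsilon$. -/

import Mathlib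

open scoped BigOperators

/-- `e(z) = exp(2 π i z)`. -/
noncomputable def eChar (z : ℂ) : ℂ :=
  Complex.exp (2 * Real.pi * Complex.I * z)

/-- The integral quadratic form `F(x) = xᵗ J x`. -/
def quadF {n : ℕ} (J : Matrix (Fin n) (Fin n) ℤ) (x : Fin n → ℤ) : ℤ :=
  x ⬝ᵥ (J.mulVec x)

/-- `S(q, c) = ∑_{a mod q} ∑_{x mod q} e((a F(x) + c · x) / q)`, summed over the
representatives `0, …, q - 1` of the residue classes. -/
noncomputable def expSum {n : ℕ} (J : Matrix (Fin n) (Fin n) ℤ) (c : Fin n → ℤ) (q : ℕ) : ℂ :=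
  ∑ a : Fin q, ∑ x : Fin n → Fin q,
    eChar ((((a : ℕ) : ℤ) * quadF J (fun i => ((x i : ℕ) : ℤ))
      + c ⬝ᵥ (fun i => ((x i : ℕ) : ℤ)) : ℤ) / (q : ℂ))

/-- The series `D(c, s) = ∑_{q ≥ 1} S(q, c) / q ^ (s + n + 1)`. -/
noncomputable def seriesD {n : ℕ} (J : Matrix (Fin n) (Fin n) ℤ) (c : Fin n → ℤ) (s : ℂ) : ℂ :=
  LSeries (expSum J c) (s + n + 1)

/-- The `k`-th term `S(p ^ k, c) / p ^ (k (s + n + 1))` of the Euler factor at `p`. -/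
noncomputable def localTerm {n : ℕ} (p : ℕ) (J : Matrix (Fin n) (Fin n) ℤ) (c : Fin n → ℤ)
    (s : ℂ) (k : ℕ) : ℂ :=
  expSum J c (p ^ k) / (p : ℂ) ^ ((k : ℂ) * (s + n + 1))

/-- The Euler factor `D_p(c, s) = ∑_{k ≥ 0} S(p ^ k, c) / p ^ (k (s + n + 1))`. -/
noncomputable def seriesDp {n : ℕ} (p : ℕ) (J : Matrix (Fin n) (Fin n) ℤ) (c : Fin n → ℤ)
    (s : ℂ) : ℂ :=
  ∑' k : ℕ, localTerm p J c s k

/-- `(1 - 2^{-(s+1)}) (1 - 2^{-(2s+n)}) / (1 - 2^{-(2s+n+1)})`. -/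
noncomputable def twoFactor (n : ℕ) (s : ℂ) : ℂ :=
  (1 - (2 : ℂ) ^ (-(s + 1))) * (1 - (2 : ℂ) ^ (-(2 * s + n))) /
    (1 - (2 : ℂ) ^ (-(2 * s + n + 1)))

/-- `ζ(s+1) ζ(2s+n) / ζ(2s+n+1)`. -/
noncomputable def zetaQuotient (n : ℕ) (s : ℂ) : ℂ :=
  riemannZeta (s + 1) * riemannZeta (2 * s + n) / riemannZeta (2 * s + n + 1)

/-- For signs `b`, of which `m` are `+1`: the constant `2^{(n-1)/2}` if `2m - n ≡ 1, 7 (mod 8)`,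
and `-2^{(n-1)/2}` otherwise (for odd `n`: if `2m - n ≡ 3, 5 (mod 8)`). -/
def dConst {n : ℕ} (b : Fin n → ℤ) : ℤ :=
  let r : ℤ := (2 * ((Finset.univ.filter (fun i => b i = 1)).card : ℤ) - n) % 8
  if r = 1 ∨ r = 7 then 2 ^ ((n - 1) / 2) else -2 ^ ((n - 1) / 2)

/-- `F` is the meromorphic continuation to `ℂ` of the function `f` given on the half plane
`Re s > σ₀`. Normal form means that `F` is analytic outside its poles, where it takes the
value `0`; hence `F` is determined by `f` at every point. -/
structure IsMeromorphicContinuation (f : ℂ → ℂ) (σ₀ : ℝ) (F : ℂ → ℂ) : Prop where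
  meromorphic : MeromorphicNFOn F Set.univ
  eq_of_lt : ∀ s : ℂ, σ₀ < s.re → F s = f s

/-! For `c = 0` the sum over `x` factors: `S(q, 0)` is the sum over `a` mod `q` of the product of
the one-variable Gauss sums `G(q; a b_i)`. At `q = p^(k+1)` the multiples of `p` among the `a`
reproduce `p^n S(p^k, 0)`; let `C(p^(k+1))` be the rest. Evaluating Gauss sums modulo prime powers
shows, for odd `n`, that `C` vanishes at odd exponents and that `C(p^(2k)) = c p^((n+2)k)` for `k ≥
1`, with `c = 1 - 1/p` for odd `p` and `c = d/2` for `p = 2`.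

With `X = p^(-(2s+n))` the recursion sums to `D_p = 1 + p^(-(s+1)) D_p + c X / (1 - X)`, so `D_p (1
- p^(-(s+1))) (1 - X) = 1 - X + c X` (`seriesDp_diagonal_mul`). For odd `p` the right side is `1 -
X/p`, and `D_p` is the Euler factor of the zeta quotient; `p = 2` leaves the correction in the
theorem.

Orthogonality in `a` also gives `S(q, 0) = q N(q)`, with `N` counting the zeros of `F` mod `q`.
Hence `S` is multiplicative and at most `q^(n+1)`, which yields the Euler product and absolute
convergence for `σ > 1`. The continuations are those of the explicit right-hand sides. -/

/-- The additive character `m ↦ e(m / q)` of `ℤ`. -/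
noncomputable def ratChar (q : ℕ) (m : ℤ) : ℂ := eChar ((m : ℂ) / q)

/-- The quadratic Gauss sum `∑_{x mod q} e(a x² / q)`. -/
noncomputable def quadGauss (q : ℕ) (a : ℤ) : ℂ :=
  ∑ x ∈ Finset.range q, ratChar q (a * (x : ℤ) ^ 2)

/-! ### Additive characters and sums over residues -/

lemma ratChar_add (q : ℕ) (m k : ℤ) : ratChar q (m + k) = ratChar q m * ratChar q k := by
  simp only [ratChar, eChar, ← Complex.exp_add]
  congr 1; push_cast; ring

lemma ratChar_zero (q : ℕ) : ratChar q 0 = 1 := by simp [ratChar, eChar]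

lemma ratChar_mul_cancel {p : ℕ} (hp : p ≠ 0) (q : ℕ) (m : ℤ) :
    ratChar (p * q) (p * m) = ratChar q m := by
  have : (p : ℂ) ≠ 0 := by exact_mod_cast hp
  simp only [ratChar]
  congr 1; push_cast
  rw [mul_div_mul_left _ _ this]

lemma ratChar_mul_self {q : ℕ} (hq : q ≠ 0) (m : ℤ) : ratChar q (q * m) = 1 := by
  have : (q : ℂ) ≠ 0 := by exact_mod_cast hq
  simp only [ratChar, eChar]
  rw [Complex.exp_eq_one_iff]
  refine ⟨m, ?_⟩
  push_cast; field_simp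

lemma ratChar_eq_of_dvd_sub {q : ℕ} (hq : q ≠ 0) {m k : ℤ} (h : (q : ℤ) ∣ m - k) :
    ratChar q m = ratChar q k := by
  obtain ⟨c, hc⟩ := h
  rw [show m = k + q * c by linarith, ratChar_add, ratChar_mul_self hq, mul_one]

lemma ratChar_eq_stdAddChar (q : ℕ) [NeZero q] (m : ℤ) :
    ratChar q m = ZMod.stdAddChar (m : ZMod q) := by
  rw [ZMod.stdAddChar_coe, ratChar, eChar]
  congr 1; ring

lemma sum_range_eq_sum_zmod (q : ℕ) [NeZero q] {M : Type*} [AddCommMonoid M] (f : ZMod q → M) :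
    ∑ x ∈ Finset.range q, f x = ∑ x : ZMod q, f x := by
  refine Finset.sum_bij (fun x _ => (x : ZMod q)) (fun _ _ => Finset.mem_univ _) ?_ ?_
    (fun _ _ => rfl)
  · intro x hx y hy h
    have := congrArg ZMod.val h
    simpa [ZMod.val_cast_of_lt (Finset.mem_range.1 hx),
      ZMod.val_cast_of_lt (Finset.mem_range.1 hy)] using this
  · intro y _
    exact ⟨y.val, Finset.mem_range.2 (ZMod.val_lt y), by simp⟩

lemma sum_ratChar_mul (q : ℕ) (hq : q ≠ 0) (m : ℤ) :
    ∑ z ∈ Finset.range q, ratChar q (m * z) = if (q : ℤ) ∣ m then (q : ℂ) else 0 := by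
  have : NeZero q := ⟨hq⟩
  have h := AddChar.sum_mulShift (m : ZMod q) (ZMod.isPrimitive_stdAddChar q)
  rw [← sum_range_eq_sum_zmod q (fun x => ZMod.stdAddChar (x * (m : ZMod q)))] at h
  simp only [ZMod.intCast_zmod_eq_zero_iff_dvd, ZMod.card] at h
  push_cast at h
  rw [← h]
  refine Finset.sum_congr rfl fun x _ => ?_
  rw [ratChar_eq_stdAddChar]; push_cast; rw [mul_comm]

lemma sum_range_mul_eq {M : Type*} [AddCommMonoid M] (A B : ℕ) (f : ℕ → M) :
    ∑ i ∈ Finset.range (A * B), f i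
      = ∑ y ∈ Finset.range A, ∑ z ∈ Finset.range B, f (y + A * z) := by
  rw [Finset.sum_comm]
  induction B with
  | zero => simp
  | succ B ih =>
    rw [Nat.mul_succ, Finset.sum_range_add, Finset.sum_range_succ, ih]
    simp [add_comm]

lemma sum_range_mul_dvd {M : Type*} [AddCommMonoid M] (p q : ℕ) (hp : p ≠ 0) (f : ℕ → M) :
    ∑ i ∈ Finset.range (p * q), (if p ∣ i then f i else 0)
      = ∑ w ∈ Finset.range q, f (p * w) := by
  rw [sum_range_mul_eq, Finset.sum_eq_single 0]
  · simp
  · intro y hy h0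
    refine Finset.sum_eq_zero fun z _ => if_neg ?_
    rw [Nat.dvd_add_left (Dvd.intro _ rfl)]
    exact fun h => absurd (Nat.le_of_dvd (Nat.pos_of_ne_zero h0) h)
      (not_le.2 (Finset.mem_range.1 hy))
  · simp [Nat.pos_of_ne_zero hp]

lemma sum_range_mul_of_periodic (A B : ℕ) (f : ℕ → ℂ) (hf : ∀ y z, f (y + A * z) = f y) :
    ∑ i ∈ Finset.range (A * B), f i = B * ∑ y ∈ Finset.range A, f y := by
  simp [sum_range_mul_eq, hf, Finset.mul_sum]

/-! ### Recursions for quadratic Gauss sums modulo prime powers -/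

lemma quadGauss_mul_mul {p q : ℕ} (hp : p ≠ 0) (hq : q ≠ 0) (a : ℤ) :
    quadGauss (p * q) (p * a) = p * quadGauss q a := by
  unfold quadGauss
  simp only [mul_assoc, ratChar_mul_cancel hp]
  rw [mul_comm p q, sum_range_mul_of_periodic]
  intro y z
  refine ratChar_eq_of_dvd_sub hq ⟨a * (2 * y * z + q * z ^ 2), ?_⟩
  push_cast; ring

/-- Put `x = y + p^(k+1) z`. Modulo `p^(k+2)` the square is linear in `z`, so summing over `z` mod
`p` kills every `y` prime to `p`; the survivors `y = p w` give the sum modulo `p^k`. -/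
lemma quadGauss_prime_pow_add_two {p : ℕ} (hp : p.Prime) (hp2 : p ≠ 2) {a : ℤ}
    (ha : ¬ (p : ℤ) ∣ a) (k : ℕ) :
    quadGauss (p ^ (k + 2)) a = p * quadGauss (p ^ k) a := by
  have hp0 : p ≠ 0 := hp.ne_zero
  have hpz : Prime (p : ℤ) := Nat.prime_iff_prime_int.1 hp
  have h2 : ¬ (p : ℤ) ∣ 2 := fun h =>
    hp2 ((Nat.prime_dvd_prime_iff_eq hp Nat.prime_two).1 (by exact_mod_cast h))
  unfold quadGauss
  conv_lhs => rw [show p ^ (k + 2) = p ^ (k + 1) * p by ring]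
  rw [sum_range_mul_eq]
  have key : ∀ y ∈ Finset.range (p ^ (k + 1)),
      ∑ z ∈ Finset.range p, ratChar (p ^ (k + 1) * p) (a * ((y + p ^ (k + 1) * z : ℕ) : ℤ) ^ 2)
        = if p ∣ y then (p : ℂ) * ratChar (p ^ (k + 2)) (a * (y : ℤ) ^ 2) else 0 := by
    intro y _
    have : ∀ z ∈ Finset.range p,
        ratChar (p ^ (k + 1) * p) (a * ((y + p ^ (k + 1) * z : ℕ) : ℤ) ^ 2)
        = ratChar (p ^ (k + 2)) (a * (y : ℤ) ^ 2) * ratChar p ((2 * a * y) * z) := by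
      intro z _
      rw [← ratChar_mul_cancel (pow_ne_zero (k + 1) hp0) p,
        show p ^ (k + 1) * p = p ^ (k + 2) by ring, ← ratChar_add]
      refine ratChar_eq_of_dvd_sub (pow_ne_zero _ hp0) ⟨a * p ^ k * z ^ 2, ?_⟩
      push_cast; ring
    rw [Finset.sum_congr rfl this, ← Finset.mul_sum, sum_ratChar_mul p hp0]
    have hiff : (p : ℤ) ∣ 2 * a * y ↔ p ∣ y := by
      rw [hpz.dvd_mul, hpz.dvd_mul, Int.natCast_dvd_natCast]
      tauto
    simp only [hiff]
    split_ifs <;> ring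
  rw [Finset.sum_congr rfl key, pow_succ' p k, sum_range_mul_dvd p _ hp0, Finset.mul_sum]
  refine Finset.sum_congr rfl fun w _ => ?_
  rw [← ratChar_mul_cancel (pow_ne_zero 2 hp0) (p ^ k)]
  congr 2
  · ring
  · push_cast; ring

/-- The same argument, but the factor 2 in the cross term calls for `z` mod 4, with `x = y + 2^(k+2)
z`. The survivors `y = 2 w` have `w` mod `2^(k+1)`, half a full system modulo `2^(k+2)`, so the
factor 4 becomes 2. The recursion starts from the moduli 4 and 8. -/
lemma quadGauss_two_pow_add_four {a : ℤ} (ha : ¬ (2 : ℤ) ∣ a) (k : ℕ) :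
    quadGauss (2 ^ (k + 4)) a = 2 * quadGauss (2 ^ (k + 2)) a := by
  unfold quadGauss
  conv_lhs => rw [show 2 ^ (k + 4) = 2 ^ (k + 2) * 4 by ring]
  rw [sum_range_mul_eq]
  have key : ∀ y ∈ Finset.range (2 ^ (k + 2)),
      ∑ z ∈ Finset.range 4, ratChar (2 ^ (k + 2) * 4) (a * ((y + 2 ^ (k + 2) * z : ℕ) : ℤ) ^ 2)
        = if 2 ∣ y then (4 : ℂ) * ratChar (2 ^ (k + 4)) (a * (y : ℤ) ^ 2) else 0 := by
    intro y _
    have : ∀ z ∈ Finset.range 4,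
        ratChar (2 ^ (k + 2) * 4) (a * ((y + 2 ^ (k + 2) * z : ℕ) : ℤ) ^ 2)
        = ratChar (2 ^ (k + 4)) (a * (y : ℤ) ^ 2) * ratChar 4 ((2 * a * y) * z) := by
      intro z _
      rw [← ratChar_mul_cancel (pow_ne_zero (k + 2) two_ne_zero) 4,
        show 2 ^ (k + 2) * 4 = 2 ^ (k + 4) by ring, ← ratChar_add]
      refine ratChar_eq_of_dvd_sub (pow_ne_zero _ two_ne_zero) ⟨a * 2 ^ k * z ^ 2, ?_⟩
      push_cast; ring
    rw [Finset.sum_congr rfl this, ← Finset.mul_sum, sum_ratChar_mul 4 (by norm_num)]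
    have hiff : ((4 : ℕ) : ℤ) ∣ 2 * a * y ↔ 2 ∣ y := by
      have h4 : ((4 : ℕ) : ℤ) = 2 * 2 := by norm_num
      rw [h4, mul_assoc, mul_dvd_mul_iff_left two_ne_zero, Int.prime_two.dvd_mul]
      omega
    simp only [hiff]
    split_ifs <;> push_cast <;> ring
  rw [Finset.sum_congr rfl key, pow_succ' 2 (k + 1), sum_range_mul_dvd 2 _ two_ne_zero,
    mul_comm 2 (2 ^ (k + 1)), sum_range_mul_of_periodic, ← Finset.mul_sum]
  · push_cast
    rw [← mul_assoc]
    norm_num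
    refine Finset.sum_congr rfl fun w _ => ?_
    rw [show 2 ^ (k + 4) = 2 ^ 2 * (2 ^ (k + 1) * 2) by ring,
      ← ratChar_mul_cancel (pow_ne_zero 2 two_ne_zero) (2 ^ (k + 1) * 2)]
    congr 1
    push_cast; ring
  · intro y z
    refine ratChar_eq_of_dvd_sub (by positivity) ⟨a * (y * z + 2 ^ k * z ^ 2), ?_⟩
    push_cast; ring

/-! ### The sum `S(q, 0)` through Gauss sums -/

lemma quadF_diagonal {n : ℕ} (b x : Fin n → ℤ) :
    quadF (Matrix.diagonal b) x = ∑ i, b i * x i ^ 2 := by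
  simp only [quadF, dotProduct, Matrix.mulVec_diagonal]
  exact Finset.sum_congr rfl fun i _ => by ring

lemma ratChar_sum {ι : Type*} (q : ℕ) (s : Finset ι) (f : ι → ℤ) :
    ratChar q (∑ i ∈ s, f i) = ∏ i ∈ s, ratChar q (f i) := by
  classical
  induction s using Finset.induction_on with
  | empty => simp [ratChar_zero]
  | insert i s hi ih => rw [Finset.sum_insert hi, Finset.prod_insert hi, ratChar_add, ih]

lemma expSum_zero_eq {n : ℕ} (J : Matrix (Fin n) (Fin n) ℤ) (q : ℕ) :
    expSum J 0 q = ∑ a ∈ Finset.range q, ∑ x : Fin n → Fin q,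
      ratChar q (a * quadF J (fun i => ((x i : ℕ) : ℤ))) := by
  rw [← Fin.sum_univ_eq_sum_range (fun a => ∑ x : Fin n → Fin q,
      ratChar q (a * quadF J (fun i => ((x i : ℕ) : ℤ)))) q]
  simp [expSum, ratChar]

lemma expSum_diagonal_eq {n : ℕ} (b : Fin n → ℤ) (q : ℕ) :
    expSum (Matrix.diagonal b) 0 q
      = ∑ a ∈ Finset.range q, ∏ i, quadGauss q (a * b i) := by
  rw [expSum_zero_eq]
  refine Finset.sum_congr rfl fun a _ => ?_
  have h : ∀ i, quadGauss q (a * b i)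
      = ∑ x : Fin q, ratChar q (a * b i * ((x : ℕ) : ℤ) ^ 2) := fun i =>
    (Fin.sum_univ_eq_sum_range (fun x : ℕ => ratChar q (a * b i * (x : ℤ) ^ 2)) q).symm
  simp only [h]
  rw [Finset.prod_univ_sum, Fintype.piFinset_univ]
  refine Finset.sum_congr rfl fun x _ => ?_
  rw [quadF_diagonal, Finset.mul_sum, ratChar_sum]
  simp only [mul_assoc]

/-- The part of the sum over `a` mod `q` that runs over the `a` prime to `p`. -/
noncomputable def coprimePart {n : ℕ} (b : Fin n → ℤ) (p q : ℕ) : ℂ :=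
  ∑ a ∈ Finset.range q, if p ∣ a then 0 else ∏ i, quadGauss q (a * b i)

/-- The terms `a = p a'` lower the modulus from `p^(k+1)` to `p^k`, and each of the `n` Gauss sums
contributes a factor `p`. -/
lemma expSum_prime_pow_succ {n : ℕ} (b : Fin n → ℤ) {p : ℕ} (hp : p ≠ 0) (k : ℕ) :
    expSum (Matrix.diagonal b) 0 (p ^ (k + 1))
      = (p : ℂ) ^ n * expSum (Matrix.diagonal b) 0 (p ^ k) + coprimePart b p (p ^ (k + 1)) := by
  rw [expSum_diagonal_eq, expSum_diagonal_eq, coprimePart]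
  have : ∀ a ∈ Finset.range (p ^ (k + 1)), ∏ i, quadGauss (p ^ (k + 1)) (a * b i)
      = (if p ∣ a then ∏ i, quadGauss (p ^ (k + 1)) (a * b i) else 0)
        + (if p ∣ a then 0 else ∏ i, quadGauss (p ^ (k + 1)) (a * b i)) := by
    intro a _; split_ifs <;> simp
  rw [Finset.sum_congr rfl this, Finset.sum_add_distrib]
  congr 1
  rw [pow_succ' p k, sum_range_mul_dvd p _ hp
    (fun a : ℕ => ∏ i, quadGauss (p * p ^ k) (a * b i)), Finset.mul_sum]
  refine Finset.sum_congr rfl fun a _ => ?_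
  push_cast
  simp only [mul_assoc, quadGauss_mul_mul hp (pow_ne_zero k hp)]
  simp [Finset.prod_mul_distrib]

lemma expSum_one {n : ℕ} (b : Fin n → ℤ) : expSum (Matrix.diagonal b) 0 1 = 1 := by
  simp [expSum_diagonal_eq, quadGauss, ratChar_zero]

section Signs

variable {n : ℕ} {b : Fin n → ℤ} (hb : ∀ i, b i = 1 ∨ b i = -1)
include hb

lemma not_dvd_mul_sign {p a : ℤ} (ha : ¬ p ∣ a) (i : Fin n) : ¬ p ∣ a * b i := by
  rcases hb i with h | h <;> simpa [h] using ha

end Signs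

lemma quadGauss_one (a : ℤ) : quadGauss 1 a = 1 := by simp [quadGauss, ratChar_zero]

/-! ### Odd primes -/

section OddPrime

variable {p : ℕ}

lemma quadGauss_prime_pow_even (hp : p.Prime) (hp2 : p ≠ 2) {a : ℤ} (ha : ¬ (p : ℤ) ∣ a)
    (k : ℕ) : quadGauss (p ^ (2 * k)) a = (p : ℂ) ^ k := by
  induction k with
  | zero => simp [quadGauss_one]
  | succ k ih => rw [Nat.mul_succ, quadGauss_prime_pow_add_two hp hp2 ha, ih, pow_succ']

lemma quadGauss_prime_pow_odd (hp : p.Prime) (hp2 : p ≠ 2) {a : ℤ} (ha : ¬ (p : ℤ) ∣ a)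
    (k : ℕ) : quadGauss (p ^ (2 * k + 1)) a = (p : ℂ) ^ k * quadGauss p a := by
  induction k with
  | zero => simp
  | succ k ih =>
    rw [show 2 * (k + 1) + 1 = 2 * k + 1 + 2 by ring, quadGauss_prime_pow_add_two hp hp2 ha, ih]
    ring

/-- A residue `y` has `χ(y) + 1` square roots, which turns the quadratic sum into the Gauss sum of
`χ`. Only the dependence on `a` is used later, so the value of `g` is left open. -/
lemma exists_quadGauss_prime (hp : p.Prime) (hp2 : p ≠ 2) : ∃ g : ℂ, ∀ a : ℤ, ¬ (p : ℤ) ∣ a →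
    haveI : Fact p.Prime := ⟨hp⟩
    quadGauss p a = quadraticChar (ZMod p) (a : ZMod p) * g := by
  have : Fact p.Prime := ⟨hp⟩
  let χ : MulChar (ZMod p) ℂ := (quadraticChar (ZMod p)).ringHomComp (Int.castRingHom ℂ)
  let ψ : AddChar (ZMod p) ℂ := ZMod.stdAddChar
  have hchar : ringChar (ZMod p) ≠ 2 := by rwa [ZMod.ringChar_zmod_n]
  refine ⟨gaussSum χ ψ, fun a ha => ?_⟩
  have ha' : (a : ZMod p) ≠ 0 := by rwa [Ne, ZMod.intCast_zmod_eq_zero_iff_dvd]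
  have h1 : quadGauss p a = ∑ x : ZMod p, ψ (a * x ^ 2) := by
    rw [← sum_range_eq_sum_zmod p (fun x => ψ (a * x ^ 2))]
    refine Finset.sum_congr rfl fun x _ => ?_
    rw [ratChar_eq_stdAddChar]; push_cast; rfl
  have h2 : ∑ x : ZMod p, ψ (a * x ^ 2) = ∑ y : ZMod p, (χ y + 1) * ψ (a * y) := by
    rw [← Finset.sum_fiberwise (s := Finset.univ) (g := fun x : ZMod p => x ^ 2)]
    refine Finset.sum_congr rfl fun y _ => ?_
    have hc := quadraticChar_card_sqrts hchar y
    rw [Finset.sum_congr rfl (g := fun _ => ψ (a * y))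
      (fun x hx => by rw [(Finset.mem_filter.1 hx).2]), Finset.sum_const, nsmul_eq_mul]
    congr 1
    have : ((Finset.univ.filter fun x : ZMod p => x ^ 2 = y).card : ℤ)
        = quadraticChar (ZMod p) y + 1 := by
      rw [← hc]; congr 2; ext x; simp
    have := congrArg (Int.cast : ℤ → ℂ) this
    push_cast at this
    rw [this]; rfl
  have h3 : ∑ y : ZMod p, ψ (a * y) = 0 := by
    have := AddChar.sum_mulShift (a : ZMod p) (ZMod.isPrimitive_stdAddChar p)
    rw [if_neg ha'] at this
    rw [← Nat.cast_zero, ← this]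
    exact Finset.sum_congr rfl fun x _ => by rw [mul_comm]
  have h4 := gaussSum_mulShift χ ψ (Units.mk0 _ ha')
  have h5 : χ (a : ZMod p) * χ a = 1 := by
    have := quadraticChar_sq_one ha'
    have := congrArg (Int.cast : ℤ → ℂ) this
    push_cast at this
    rw [← sq]; exact this
  rw [h1, h2]
  simp only [add_mul, one_mul, Finset.sum_add_distrib, h3, add_zero]
  change gaussSum χ (ψ.mulShift a) = χ a * gaussSum χ ψ
  rw [← h4, Units.val_mk0, ← mul_assoc, h5, one_mul]

lemma sum_range_pow_of_periodic (k : ℕ) (f : ℕ → ℂ)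
    (hf : ∀ y z, f (y + p * z) = f y) :
    ∑ a ∈ Finset.range (p ^ (k + 1)), (if p ∣ a then 0 else f a)
      = (p : ℂ) ^ k * ∑ a ∈ Finset.range p, (if p ∣ a then 0 else f a) := by
  rw [pow_succ' p k, sum_range_mul_of_periodic]
  · push_cast; rfl
  · intro y z
    simp only [hf, Nat.dvd_add_left (Dvd.intro z rfl)]

variable {n : ℕ} {b : Fin n → ℤ} (hb : ∀ i, b i = 1 ∨ b i = -1)
include hb

/-- At an even exponent the Gauss sum does not depend on `a`, so the sum just counts the units
modulo `p^(2k+2)`. -/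
lemma coprimePart_prime_pow_even (hp : p.Prime) (hp2 : p ≠ 2) (k : ℕ) :
    coprimePart b p (p ^ (2 * k + 2))
      = (1 - 1 / (p : ℂ)) * ((p : ℂ) ^ (n + 2)) ^ (k + 1) := by
  have hp0 : (p : ℂ) ≠ 0 := by exact_mod_cast hp.ne_zero
  have h : ∀ a ∈ Finset.range (p ^ (2 * k + 1 + 1)),
      (if p ∣ a then 0 else ∏ i, quadGauss (p ^ (2 * k + 2)) (a * b i))
        = if p ∣ a then 0 else ((p : ℂ) ^ (k + 1)) ^ n := by
    intro a _
    split_ifs with ha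
    · rfl
    · have hq : ∀ i ∈ Finset.univ, quadGauss (p ^ (2 * k + 2)) (a * b i) = (p : ℂ) ^ (k + 1) :=
        fun i _ => quadGauss_prime_pow_even (k := k + 1) hp hp2
          (not_dvd_mul_sign hb (Int.natCast_dvd_natCast.not.2 ha) i)
      rw [Finset.prod_congr rfl hq]
      simp
  rw [coprimePart, Finset.sum_congr rfl h,
    sum_range_pow_of_periodic _ (fun _ => _) (fun _ _ => rfl)]
  have h2 : ∑ a ∈ Finset.range p, (if p ∣ a then 0 else ((p : ℂ) ^ (k + 1)) ^ n)
      = (p - 1) * ((p : ℂ) ^ (k + 1)) ^ n := by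
    obtain ⟨m, rfl⟩ := Nat.exists_eq_succ_of_ne_zero hp.ne_zero
    rw [Finset.sum_range_succ', if_pos (dvd_zero _), add_zero, Finset.sum_congr rfl
      (g := fun _ => (((m.succ : ℕ) : ℂ) ^ (k + 1)) ^ n)
      (fun a ha => if_neg fun h => absurd (Nat.le_of_dvd a.succ_pos h)
        (by have := Finset.mem_range.1 ha; omega))]
    simp
  rw [h2]
  field_simp
  ring

/-- At an odd exponent each Gauss sum carries `χ(a)`; as `n` is odd, the product carries `χ(a)^n =
χ(a)`, which sums to zero. -/
lemma coprimePart_prime_pow_odd (hn : Odd n) (hp : p.Prime) (hp2 : p ≠ 2) (k : ℕ) :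
    coprimePart b p (p ^ (2 * k + 1)) = 0 := by
  have : Fact p.Prime := ⟨hp⟩
  have hchar : ringChar (ZMod p) ≠ 2 := by rwa [ZMod.ringChar_zmod_n]
  obtain ⟨g, hg⟩ := exists_quadGauss_prime hp hp2
  set χ := quadraticChar (ZMod p)
  let c : ℂ := ∏ i, ((p : ℂ) ^ k * (χ ((b i : ℤ) : ZMod p) * g))
  have h : ∀ a ∈ Finset.range (p ^ (2 * k + 1)),
      (if p ∣ a then 0 else ∏ i, quadGauss (p ^ (2 * k + 1)) (a * b i))
        = if p ∣ a then 0 else (χ (a : ZMod p) : ℂ) * c := by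
    intro a _
    split_ifs with ha
    · rfl
    · have ha' : ¬ (p : ℤ) ∣ a := Int.natCast_dvd_natCast.not.2 ha
      have haz : (a : ZMod p) ≠ 0 := by rwa [Ne, ZMod.natCast_eq_zero_iff]
      have hprod : ∀ i ∈ Finset.univ, quadGauss (p ^ (2 * k + 1)) (a * b i)
          = (χ (a : ZMod p) : ℂ) * ((p : ℂ) ^ k * (χ ((b i : ℤ) : ZMod p) * g)) := by
        intro i _
        rw [quadGauss_prime_pow_odd hp hp2 (not_dvd_mul_sign hb ha' i),
          hg _ (not_dvd_mul_sign hb ha' i)]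
        push_cast
        rw [map_mul]; push_cast; ring
      rw [Finset.prod_congr rfl hprod, Finset.prod_mul_distrib, Finset.prod_const,
        Finset.card_univ, Fintype.card_fin]
      congr 1
      obtain ⟨m, rfl⟩ := hn
      have h1 : χ (a : ZMod p) ^ (2 * m + 1) = χ (a : ZMod p) := by
        rw [pow_succ, pow_mul, quadraticChar_sq_one haz, one_pow, one_mul]
      exact_mod_cast h1
  rw [coprimePart, Finset.sum_congr rfl h, sum_range_pow_of_periodic _
    (fun a => (χ (a : ZMod p) : ℂ) * c) (fun y z => by simp)]
  have h2 : ∀ a ∈ Finset.range p, (if p ∣ a then 0 else (χ (a : ZMod p) : ℂ) * c)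
      = (χ (a : ZMod p) : ℂ) * c := by
    intro a _
    split_ifs with ha
    · rw [(ZMod.natCast_eq_zero_iff a p).2 ha, MulChar.map_zero]; simp
    · rfl
  rw [Finset.sum_congr rfl h2, ← Finset.sum_mul,
    sum_range_eq_sum_zmod p (fun a => (χ a : ℂ)), ← Int.cast_sum, quadraticChar_sum_zero hchar]
  simp

end OddPrime

/-! ### The prime 2 -/

lemma ratChar_four_one : ratChar 4 1 = Complex.I := by
  rw [ratChar, eChar, show 2 * (Real.pi : ℂ) * Complex.I * (((1 : ℤ) : ℂ) / ((4 : ℕ) : ℂ))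
    = Real.pi / 2 * Complex.I by push_cast; ring, Complex.exp_pi_div_two_mul_I]

lemma ratChar_two_of_odd {a : ℤ} (ha : ¬ (2 : ℤ) ∣ a) : ratChar 2 a = -1 := by
  rw [ratChar_eq_of_dvd_sub (k := 1) two_ne_zero (by push_cast; omega), ratChar, eChar,
    show 2 * (Real.pi : ℂ) * Complex.I * (((1 : ℤ) : ℂ) / ((2 : ℕ) : ℂ))
    = Real.pi * Complex.I by push_cast; ring, Complex.exp_pi_mul_I]

lemma ratChar_four_neg_one : ratChar 4 (-1) = -Complex.I := by
  have h : ratChar 4 (-1) = ratChar (2 * 2) (2 * 1) * ratChar 4 1 := by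
    rw [← ratChar_add]; exact ratChar_eq_of_dvd_sub (by norm_num) (by norm_num)
  have h2 := ratChar_mul_cancel (p := 2) two_ne_zero 2 1
  rw [h]
  push_cast at h2 ⊢
  rw [h2, ratChar_two_of_odd (by norm_num), ratChar_four_one]; ring

lemma quadGauss_two_of_odd {a : ℤ} (ha : ¬ (2 : ℤ) ∣ a) : quadGauss 2 a = 0 := by
  simp [quadGauss, Finset.sum_range_succ, ratChar_zero, ratChar_two_of_odd ha]

lemma quadGauss_four (a : ℤ) : quadGauss 4 a = 2 * (1 + ratChar 4 a) := by
  have h2 : ratChar 4 (a * 4) = 1 := by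
    rw [ratChar_eq_of_dvd_sub (k := 0) (by norm_num) ⟨a, by push_cast; ring⟩, ratChar_zero]
  have h3 : ratChar 4 (a * 9) = ratChar 4 a :=
    ratChar_eq_of_dvd_sub (by norm_num) ⟨2 * a, by push_cast; ring⟩
  simp [quadGauss, Finset.sum_range_succ, ratChar_zero, h2, h3]
  ring

lemma ratChar_eight_four_mul {a : ℤ} (ha : ¬ (2 : ℤ) ∣ a) : ratChar 8 (4 * a) = -1 := by
  have h := ratChar_mul_cancel (p := 4) (by norm_num) 2 a
  push_cast at h
  rw [h, ratChar_two_of_odd ha]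

lemma quadGauss_eight_of_odd {a : ℤ} (ha : ¬ (2 : ℤ) ∣ a) :
    quadGauss 8 a = 4 * ratChar 8 a := by
  have h : ∀ x c : ℤ, (8 : ℤ) ∣ x - c → ratChar 8 (a * x) = ratChar 8 (c * a) := by
    rintro x c ⟨t, ht⟩
    refine ratChar_eq_of_dvd_sub (by norm_num) ⟨a * t, ?_⟩
    push_cast
    linear_combination a * ht
  have h4 := ratChar_eight_four_mul ha
  simp only [quadGauss, Finset.sum_range_succ, Finset.sum_range_zero]
  push_cast
  rw [h 0 0 (by norm_num), h 1 1 (by norm_num), h 4 4 (by norm_num),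
    h 9 1 (by norm_num), h 16 0 (by norm_num), h 25 1 (by norm_num),
    h 36 4 (by norm_num), h 49 1 (by norm_num), h4, zero_mul, ratChar_zero, one_mul]
  ring

lemma quadGauss_two_pow_even {a : ℤ} (ha : ¬ (2 : ℤ) ∣ a) (k : ℕ) :
    quadGauss (2 ^ (2 * k + 2)) a = 2 ^ (k + 1) * (1 + ratChar 4 a) := by
  induction k with
  | zero => simpa using quadGauss_four a
  | succ k ih =>
    rw [show 2 * (k + 1) + 2 = 2 * k + 4 by ring, quadGauss_two_pow_add_four ha, ih]
    ring

lemma quadGauss_two_pow_odd {a : ℤ} (ha : ¬ (2 : ℤ) ∣ a) (k : ℕ) :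
    quadGauss (2 ^ (2 * k + 3)) a = 2 ^ (k + 2) * ratChar 8 a := by
  induction k with
  | zero => norm_num [quadGauss_eight_of_odd ha]
  | succ k ih =>
    rw [show 2 * (k + 1) + 3 = 2 * k + 1 + 4 by ring, quadGauss_two_pow_add_four ha,
      show 2 * k + 1 + 2 = 2 * k + 3 by ring, ih]
    ring

/-- Since `(1 ± i)^8 = 16`, raising `l` by 4 multiplies both sides by 16; the cases `l < 4` are
computed. -/
lemma one_add_I_pow_add_conj (l : ℕ) :
    (1 + Complex.I) ^ (2 * l + 1) + (1 - Complex.I) ^ (2 * l + 1)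
      = 2 * ((if (2 * l + 1) % 8 = 1 ∨ (2 * l + 1) % 8 = 7 then 1 else -1) * 2 ^ l) := by
  have hI := Complex.I_sq
  have h8 : (1 + Complex.I) ^ 8 = 16 := by
    rw [show (1 + Complex.I) ^ 8 = ((1 + 2 * Complex.I + Complex.I ^ 2) ^ 2) ^ 2 by ring, hI]
    ring_nf; rw [show Complex.I ^ 4 = (Complex.I ^ 2) ^ 2 by ring, hI]; norm_num
  have h8' : (1 - Complex.I) ^ 8 = 16 := by
    rw [show (1 - Complex.I) ^ 8 = ((1 - 2 * Complex.I + Complex.I ^ 2) ^ 2) ^ 2 by ring, hI]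
    ring_nf; rw [show Complex.I ^ 4 = (Complex.I ^ 2) ^ 2 by ring, hI]; norm_num
  induction l using Nat.strong_induction_on with
  | _ l ih =>
    rcases lt_or_ge l 4 with h | h
    · interval_cases l
      · norm_num
      · norm_num; linear_combination 6 * hI
      · norm_num; linear_combination (10 * Complex.I ^ 2 + 10) * hI
      · norm_num
        linear_combination (14 * Complex.I ^ 4 + 56 * Complex.I ^ 2 - 14) * hI
    · obtain ⟨t, rfl⟩ := Nat.exists_eq_add_of_le h
      have := ih t (by omega)
      rw [show 2 * (4 + t) + 1 = 8 + (2 * t + 1) by ring, pow_add _ 8, pow_add _ 8, h8, h8',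
        Nat.add_mod_left, pow_add]
      linear_combination 16 * this

lemma one_add_I_pow_mul_one_sub_I_pow (m k : ℕ) (h : Odd (m + k)) :
    (1 + Complex.I) ^ m * (1 - Complex.I) ^ k + (1 - Complex.I) ^ m * (1 + Complex.I) ^ k
      = 2 * ((if ((m : ℤ) - k) % 8 = 1 ∨ ((m : ℤ) - k) % 8 = 7 then 1 else -1)
          * 2 ^ ((m + k - 1) / 2)) := by
  have key : ∀ m k : ℕ, Odd (m + k) → k ≤ m →
      (1 + Complex.I) ^ m * (1 - Complex.I) ^ k + (1 - Complex.I) ^ m * (1 + Complex.I) ^ k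
      = 2 * ((if ((m : ℤ) - k) % 8 = 1 ∨ ((m : ℤ) - k) % 8 = 7 then 1 else -1)
          * 2 ^ ((m + k - 1) / 2)) := by
    -- The relation `(1 + i)(1 - i) = 2` peels off `k` pairs and leaves the odd power `m - k`.
    intro m k h hmk
    obtain ⟨l, rfl⟩ : ∃ l, m = 2 * l + 1 + k := by
      obtain ⟨t, ht⟩ := h; exact ⟨t - k, by omega⟩
    have h1 := one_add_I_pow_add_conj l
    have h2 : (1 + Complex.I) ^ k * (1 - Complex.I) ^ k = 2 ^ k := by
      rw [← mul_pow]; congr 1; linear_combination -Complex.I_sq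
    rw [show (2 * l + 1 + k + k - 1) / 2 = l + k by omega, pow_add _ _ k, pow_add _ _ k]
    have hc : ((((2 * l + 1 + k : ℕ) : ℤ) - k) % 8 = 1 ∨ (((2 * l + 1 + k : ℕ) : ℤ) - k) % 8 = 7)
        ↔ ((2 * l + 1) % 8 = 1 ∨ (2 * l + 1) % 8 = 7) := by omega
    simp only [hc]
    rw [pow_add 2 l k]
    linear_combination (2 ^ k : ℂ) * h1 +
      ((1 + Complex.I) ^ (2 * l + 1) + (1 - Complex.I) ^ (2 * l + 1)) * h2
  rcases le_total k m with hmk | hmk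
  · exact key m k h hmk
  · have := key k m (by rwa [add_comm]) hmk
    have hc : (((m : ℤ) - k) % 8 = 1 ∨ ((m : ℤ) - k) % 8 = 7)
        ↔ (((k : ℤ) - m) % 8 = 1 ∨ ((k : ℤ) - m) % 8 = 7) := by omega
    simp only [hc]
    rw [add_comm m k, ← this]; ring

section Signs

variable {n : ℕ} {b : Fin n → ℤ} (hb : ∀ i, b i = 1 ∨ b i = -1)
include hb

/-- This is the origin of `d`: the factors are `1 + e(±1/4) = 1 ± i`, and the two products are
complex conjugates. -/
lemma prod_one_add_ratChar_four (hn : Odd n) :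
    (∏ i, (1 + ratChar 4 (b i))) + ∏ i, (1 + ratChar 4 (-b i)) = 2 * dConst b := by
  set m := (Finset.univ.filter (fun i => b i = 1)).card with hm
  set k := (Finset.univ.filter (fun i => ¬ b i = 1)).card with hk
  have hmk : m + k = n := by
    rw [hm, hk, Finset.card_filter_add_card_filter_not, Finset.card_univ, Fintype.card_fin]
  have h1 : ∏ i, (1 + ratChar 4 (b i)) = (1 + Complex.I) ^ m * (1 - Complex.I) ^ k := by
    have : ∀ i ∈ Finset.univ, 1 + ratChar 4 (b i)
        = if b i = 1 then 1 + Complex.I else 1 - Complex.I := by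
      intro i _
      rcases hb i with h | h <;> simp [h, ratChar_four_one, ratChar_four_neg_one, sub_eq_add_neg]
    rw [Finset.prod_congr rfl this, Finset.prod_ite, Finset.prod_const, Finset.prod_const]
  have h2 : ∏ i, (1 + ratChar 4 (-b i)) = (1 - Complex.I) ^ m * (1 + Complex.I) ^ k := by
    have : ∀ i ∈ Finset.univ, 1 + ratChar 4 (-b i)
        = if b i = 1 then 1 - Complex.I else 1 + Complex.I := by
      intro i _
      rcases hb i with h | h <;> simp [h, ratChar_four_one, ratChar_four_neg_one, sub_eq_add_neg]
    rw [Finset.prod_congr rfl this, Finset.prod_ite, Finset.prod_const, Finset.prod_const]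
  rw [h1, h2, one_add_I_pow_mul_one_sub_I_pow m k (by rwa [hmk]), hmk]
  have hr : (2 * (m : ℤ) - n) = (m : ℤ) - k := by rw [← hmk]; push_cast; ring
  simp only [dConst, ← hm, hr]
  split_ifs <;> push_cast <;> ring

/-- The product depends only on `a` mod 4. The classes 1 and 3 together give `2d`, and each is met
`2^(2k)` times. -/
lemma coprimePart_two_pow_even (hn : Odd n) (k : ℕ) :
    coprimePart b 2 (2 ^ (2 * k + 2))
      = ((dConst b : ℂ) / 2) * ((2 : ℂ) ^ (n + 2)) ^ (k + 1) := by
  have h : ∀ a ∈ Finset.range (2 ^ (2 * k + 2)),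
      (if 2 ∣ a then 0 else ∏ i, quadGauss (2 ^ (2 * k + 2)) (a * b i))
        = if 2 ∣ a then 0 else (2 ^ (k + 1)) ^ n * ∏ i, (1 + ratChar 4 (a * b i)) := by
    intro a _
    split_ifs with ha
    · rfl
    · rw [Finset.prod_congr rfl fun i _ => quadGauss_two_pow_even (k := k)
        (not_dvd_mul_sign hb (by omega) i)]
      simp [Finset.prod_mul_distrib]
  rw [coprimePart, Finset.sum_congr rfl h, show 2 ^ (2 * k + 2) = 4 * 2 ^ (2 * k) by ring,
    sum_range_mul_of_periodic]
  · have h3 : ∀ i, ratChar 4 (3 * b i) = ratChar 4 (-b i) := fun i =>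
      ratChar_eq_of_dvd_sub (by norm_num) ⟨b i, by push_cast; ring⟩
    simp [Finset.sum_range_succ, h3]
    have h42 : (4 : ℂ) ^ k = 2 ^ (2 * k) := by rw [pow_mul]; norm_num
    linear_combination (2 ^ (2 * k) * (2 ^ (k + 1)) ^ n) * prod_one_add_ratChar_four hb hn
      - (2 * (2 ^ (k + 1)) ^ n * dConst b) * h42
  · intro y z
    have h4 : ∀ i, ratChar 4 (((y + 4 * z : ℕ) : ℤ) * b i) = ratChar 4 (y * b i) := fun i =>
      ratChar_eq_of_dvd_sub (by norm_num) ⟨z * b i, by push_cast; ring⟩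
    have h2 : 2 ∣ y + 4 * z ↔ 2 ∣ y := by omega
    simp only [h4, h2]

/-- Modulo 2 the Gauss sums vanish. From exponent 3 on, the product is a constant times `e(a r / 8)`
with `r = ∑ b_i`, which is odd because `n` is; so the terms for `a` and `a + 4` cancel. -/
lemma coprimePart_two_pow_odd (hn : Odd n) (k : ℕ) :
    coprimePart b 2 (2 ^ (2 * k + 1)) = 0 := by
  rcases k with _ | k
  · refine Finset.sum_eq_zero fun a _ => ?_
    split_ifs with ha
    · rfl
    · have h : ∀ i, quadGauss (2 ^ (2 * 0 + 1)) (a * b i) = 0 := fun i =>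
        quadGauss_two_of_odd (not_dvd_mul_sign hb (by omega) i)
      rw [Finset.prod_congr rfl fun i _ => h i]
      simp [hn.pos.ne']
  have hr : ¬ (2 : ℤ) ∣ ∑ i, b i := by
    have : (∑ i, b i) ≡ ∑ _i : Fin n, (1 : ℤ) [ZMOD 2] := by
      refine Int.ModEq.sum fun i _ => ?_
      rcases hb i with h | h
      · rw [h]
      · rw [h]; decide
    obtain ⟨t, ht⟩ := hn
    simp only [Finset.sum_const, Finset.card_univ, Fintype.card_fin, nsmul_eq_mul,
      Int.ModEq] at this
    omega
  set r := ∑ i, b i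
  have h : ∀ a ∈ Finset.range (2 ^ (2 * (k + 1) + 1)),
      (if 2 ∣ a then 0 else ∏ i, quadGauss (2 ^ (2 * (k + 1) + 1)) (a * b i))
        = if 2 ∣ a then 0 else (2 ^ (k + 2)) ^ n * ratChar 8 (a * r) := by
    intro a _
    split_ifs with ha
    · rfl
    · have hq : ∀ i ∈ Finset.univ, quadGauss (2 ^ (2 * (k + 1) + 1)) (a * b i)
          = 2 ^ (k + 2) * ratChar 8 (a * b i) := fun i _ =>
        quadGauss_two_pow_odd (not_dvd_mul_sign hb (by omega) i) k
      rw [Finset.prod_congr rfl hq, Finset.prod_mul_distrib, ← ratChar_sum,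
        ← Finset.mul_sum]
      simp [r]
  rw [coprimePart, Finset.sum_congr rfl h,
    show 2 ^ (2 * (k + 1) + 1) = 8 * 2 ^ (2 * k) by ring, sum_range_mul_of_periodic]
  · have h5 : ratChar 8 (5 * r) = -ratChar 8 r := by
      rw [show 5 * r = r + 4 * r by ring, ratChar_add, ratChar_eight_four_mul hr]; ring
    have h7 : ratChar 8 (7 * r) = -ratChar 8 (3 * r) := by
      rw [show 7 * r = 3 * r + 4 * r by ring, ratChar_add, ratChar_eight_four_mul hr]; ring
    simp [Finset.sum_range_succ, h5, h7]
  · intro y z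
    have h4 : ratChar 8 (((y + 8 * z : ℕ) : ℤ) * r) = ratChar 8 (y * r) :=
      ratChar_eq_of_dvd_sub (by norm_num) ⟨z * r, by push_cast; ring⟩
    have h2 : 2 ∣ y + 8 * z ↔ 2 ∣ y := by omega
    simp only [h4, h2]

end Signs

/-! ### Multiplicativity and the trivial bound, by counting zeros -/

/-- The number of zeros of `∑ b_i x_i²` in `(ℤ / qℤ)ⁿ`. -/
noncomputable def numZeros {n : ℕ} (b : Fin n → ℤ) (q : ℕ) : ℕ :=
  Nat.card {x : Fin n → ZMod q // ∑ i, (b i : ZMod q) * x i ^ 2 = 0}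

lemma expSum_diagonal_eq_mul_numZeros {n : ℕ} (b : Fin n → ℤ) {q : ℕ} (hq : q ≠ 0) :
    expSum (Matrix.diagonal b) 0 q = q * numZeros b q := by
  -- For a successor, `ZMod (k + 1)` is by definition `Fin (k + 1)`, so the summation variable can
  -- be read as a vector of residues.
  obtain ⟨k, rfl⟩ := Nat.exists_eq_succ_of_ne_zero hq
  rw [expSum_zero_eq, Finset.sum_comm]
  simp only [mul_comm _ (quadF _ _), sum_ratChar_mul _ hq]
  rw [← Finset.sum_filter, Finset.sum_const, nsmul_eq_mul, mul_comm, numZeros,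
    Nat.card_eq_fintype_card, Fintype.card_subtype]
  congr 3
  ext x
  simp only [Finset.mem_filter, Finset.mem_univ, true_and]
  rw [quadF_diagonal, ← ZMod.intCast_zmod_eq_zero_iff_dvd]
  have h : ((∑ i, b i * ((x i : ℕ) : ℤ) ^ 2 : ℤ) : ZMod (k + 1))
      = ∑ i, (b i : ZMod (k + 1)) * (id (x i) : ZMod (k + 1)) ^ 2 := by
    rw [Int.cast_sum]
    refine Finset.sum_congr rfl fun i _ => ?_
    rw [Int.cast_mul, Int.cast_pow, Int.cast_natCast]
    congr 2
    exact Fin.cast_val_eq_self (x i)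
  rw [h]
  exact ⟨fun hx => Finset.mem_filter.2 ⟨Finset.mem_univ _, hx⟩,
    fun hx => (Finset.mem_filter.1 hx).2⟩

lemma numZeros_mul {n : ℕ} (b : Fin n → ℤ) {q r : ℕ} (h : q.Coprime r) :
    numZeros b (q * r) = numZeros b q * numZeros b r := by
  rw [numZeros, numZeros, numZeros, ← Nat.card_prod]
  let e := ZMod.chineseRemainder h
  let E : (Fin n → ZMod (q * r)) ≃ (Fin n → ZMod q) × (Fin n → ZMod r) :=
    (Equiv.piCongrRight fun _ => e.toEquiv).trans (Equiv.arrowProdEquivProdArrow _ _ _)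
  refine Nat.card_congr ((E.subtypeEquiv (q := fun y =>
    ∑ i, (b i : ZMod q) * y.1 i ^ 2 = 0 ∧ ∑ i, (b i : ZMod r) * y.2 i ^ 2 = 0) ?_).trans
    (Equiv.subtypeProdEquivProd
      (p := fun y : Fin n → ZMod q => ∑ i, (b i : ZMod q) * y i ^ 2 = 0)
      (q := fun y : Fin n → ZMod r => ∑ i, (b i : ZMod r) * y i ^ 2 = 0)))
  intro x
  rw [← e.map_eq_zero_iff, map_sum, Prod.ext_iff, Prod.fst_sum, Prod.snd_sum]
  simp only [map_mul, map_pow, map_intCast]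
  rfl

lemma numZeros_le {n : ℕ} (b : Fin n → ℤ) {q : ℕ} (hq : q ≠ 0) : numZeros b q ≤ q ^ n := by
  have : NeZero q := ⟨hq⟩
  refine (Nat.card_le_card_of_injective _ Subtype.val_injective).trans ?_
  simp

lemma expSum_diagonal_mul {n : ℕ} (b : Fin n → ℤ) {q r : ℕ} (h : q.Coprime r)
    (hq : q ≠ 0) (hr : r ≠ 0) :
    expSum (Matrix.diagonal b) 0 (q * r)
      = expSum (Matrix.diagonal b) 0 q * expSum (Matrix.diagonal b) 0 r := by
  rw [expSum_diagonal_eq_mul_numZeros b hq, expSum_diagonal_eq_mul_numZeros b hr,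
    expSum_diagonal_eq_mul_numZeros b (mul_ne_zero hq hr), numZeros_mul b h]
  push_cast; ring

lemma norm_expSum_diagonal_le {n : ℕ} (b : Fin n → ℤ) {q : ℕ} (hq : q ≠ 0) :
    ‖expSum (Matrix.diagonal b) 0 q‖ ≤ (q : ℝ) ^ (n + 1) := by
  rw [expSum_diagonal_eq_mul_numZeros b hq, norm_mul, Complex.norm_natCast, Complex.norm_natCast,
    pow_succ']
  gcongr
  exact_mod_cast numZeros_le b hq

/-! ### Euler factors and the Euler product -/

lemma norm_natCast_cpow_neg_lt_one {p : ℕ} (hp : 2 ≤ p) {w : ℂ} (hw : 0 < w.re) :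
    ‖(p : ℂ) ^ (-w)‖ < 1 := by
  rw [Complex.norm_natCast_cpow_of_pos (by omega), Complex.neg_re]
  exact Real.rpow_lt_one_of_one_lt_of_neg (by exact_mod_cast hp) (by linarith)

lemma one_sub_natCast_cpow_neg_ne_zero {p : ℕ} (hp : 2 ≤ p) {w : ℂ} (hw : 0 < w.re) :
    1 - (p : ℂ) ^ (-w) ≠ 0 := by
  intro h
  have := norm_natCast_cpow_neg_lt_one hp hw
  rw [← sub_eq_zero.1 h] at this
  simp at this

lemma natCast_cpow_neg_add_one {p : ℕ} (hp : p ≠ 0) (w : ℂ) :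
    (p : ℂ) ^ (-(w + 1)) = (p : ℂ) ^ (-w) / p := by
  have hp0 : (p : ℂ) ≠ 0 := by exact_mod_cast hp
  rw [show -(w + 1) = -w - 1 by ring, Complex.cpow_sub _ _ hp0, Complex.cpow_one]

section EulerFactors

variable {n : ℕ}

lemma localTerm_eq_term {p : ℕ} (hp : p ≠ 0) (J : Matrix (Fin n) (Fin n) ℤ) (c : Fin n → ℤ)
    (s : ℂ) (k : ℕ) :
    localTerm p J c s k = LSeries.term (expSum J c) (s + n + 1) (p ^ k) := by
  rw [LSeries.term_of_ne_zero (pow_ne_zero k hp), localTerm, Complex.natCast_cpow_natCast_mul]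
  push_cast; rfl

lemma LSeriesSummable_expSum_diagonal (b : Fin n → ℤ) {s : ℂ} (hs : 1 < s.re) :
    LSeriesSummable (expSum (Matrix.diagonal b) 0) (s + n + 1) := by
  refine LSeriesSummable_of_le_const_mul_rpow (x := n + 2) ?_ ⟨1, fun q hq => ?_⟩
  · simp; linarith
  · rw [one_mul, show (n : ℝ) + 2 - 1 = ((n + 1 : ℕ) : ℝ) by push_cast; ring, Real.rpow_natCast]
    exact norm_expSum_diagonal_le b hq

lemma summable_localTerm_diagonal (b : Fin n → ℤ) {s : ℂ} (hs : 1 < s.re) {p : ℕ}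
    (hp : 2 ≤ p) : Summable (localTerm p (Matrix.diagonal b) 0 s) := by
  have h := (LSeriesSummable_expSum_diagonal b hs).comp_injective (Nat.pow_right_injective hp)
  refine h.congr fun k => ?_
  rw [localTerm_eq_term (by omega)]; rfl

/-- Multiply the recursion for `S(p^(k+1), 0)` by `y^(k+1)` and sum over `k`: the first part returns
`D_p`, the second is a geometric series in `X`. -/
lemma seriesDp_diagonal_mul (b : Fin n → ℤ) {s : ℂ} (hs : 1 < s.re) {p : ℕ} (hp : 2 ≤ p) {c : ℂ}
    (hodd : ∀ k, coprimePart b p (p ^ (2 * k + 1)) = 0)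
    (heven : ∀ k, coprimePart b p (p ^ (2 * k + 2)) = c * ((p : ℂ) ^ (n + 2)) ^ (k + 1)) :
    seriesDp p (Matrix.diagonal b) 0 s *
        ((1 - (p : ℂ) ^ (-(s + 1))) * (1 - (p : ℂ) ^ (-(2 * s + n))))
      = 1 - (p : ℂ) ^ (-(2 * s + n)) + c * (p : ℂ) ^ (-(2 * s + n)) := by
  have hpn : p ≠ 0 := by omega
  have hp0 : (p : ℂ) ≠ 0 := by exact_mod_cast hpn
  set X := (p : ℂ) ^ (-(2 * s + n)) with hX
  set y := (p : ℂ) ^ (-(s + n + 1)) with hy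
  have hre : 0 < (2 * s + n).re := by
    simp; positivity
  have hX1 : ‖X‖ < 1 := norm_natCast_cpow_neg_lt_one hp hre
  have hX0 : 1 - X ≠ 0 := one_sub_natCast_cpow_neg_ne_zero hp hre
  have hA : ∀ k, localTerm p (Matrix.diagonal b) 0 s k
      = expSum (Matrix.diagonal b) 0 (p ^ k) * y ^ k := by
    intro k
    rw [localTerm, Complex.cpow_nat_mul, hy, Complex.cpow_neg, inv_pow, div_eq_mul_inv]
  have hpy : (p : ℂ) ^ n * y = (p : ℂ) ^ (-(s + 1)) := by
    rw [hy, ← Complex.cpow_natCast, ← Complex.cpow_add _ _ hp0]; congr 1; ring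
  have hpX : (p : ℂ) ^ (n + 2) * y ^ 2 = X := by
    rw [hy, hX, ← Complex.cpow_natCast, ← Complex.cpow_nat_mul, ← Complex.cpow_add _ _ hp0]
    congr 1; push_cast; ring
  -- The exponent is `k + 1`, so even `k` are the vanishing odd exponents; they account for the
  -- summand 0.
  have hB : HasSum (fun k => coprimePart b p (p ^ (k + 1)) * y ^ (k + 1))
      (0 + c * X * (1 - X)⁻¹) := by
    refine HasSum.even_add_odd ?_ ?_
    · simp only [hodd, zero_mul]; exact hasSum_zero
    · refine ((hasSum_geometric_of_norm_lt_one hX1).mul_left (c * X)).congr_fun ?_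
      intro k
      rw [show 2 * k + 1 + 1 = 2 * k + 2 by ring, heven, ← hpX]
      ring
  have hsum := summable_localTerm_diagonal b hs hp
  have h1 : seriesDp p (Matrix.diagonal b) 0 s
      = 1 + ((p : ℂ) ^ (-(s + 1)) * seriesDp p (Matrix.diagonal b) 0 s
        + c * X * (1 - X)⁻¹) := by
    have hstep : ∀ k, localTerm p (Matrix.diagonal b) 0 s (k + 1)
        = (p : ℂ) ^ (-(s + 1)) * localTerm p (Matrix.diagonal b) 0 s k
          + coprimePart b p (p ^ (k + 1)) * y ^ (k + 1) := by
      intro k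
      rw [hA, hA, expSum_prime_pow_succ b hpn, ← hpy]; ring
    conv_lhs => rw [seriesDp, hsum.tsum_eq_zero_add]
    rw [tsum_congr hstep, (hsum.mul_left _).tsum_add hB.summable, tsum_mul_left, hB.tsum_eq, hA]
    simp [expSum_one, seriesDp]
  have h2 : c * X * (1 - X)⁻¹ * (1 - X) = c * X := by field_simp
  linear_combination (1 - X) * h1 + h2

lemma hasProd_seriesDp (b : Fin n → ℤ) {s : ℂ} (hs : 1 < s.re) :
    HasProd (fun p : Nat.Primes => seriesDp p (Matrix.diagonal b) 0 s)
      (seriesD (Matrix.diagonal b) 0 s) := by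
  have hsum := LSeriesSummable_expSum_diagonal b hs
  have h := EulerProduct.eulerProduct_hasProd
    (f := LSeries.term (expSum (Matrix.diagonal b) 0) (s + n + 1)) ?_ ?_ hsum.norm ?_
  · refine h.congr_fun ?_
    intro p
    exact tsum_congr fun k => localTerm_eq_term p.2.ne_zero _ _ _ _
  · simp [expSum_one]
  · intro q r hqr
    rcases eq_or_ne q 0 with rfl | hq
    · simp
    rcases eq_or_ne r 0 with rfl | hr
    · simp
    rw [LSeries.term_of_ne_zero hq, LSeries.term_of_ne_zero hr,
      LSeries.term_of_ne_zero (mul_ne_zero hq hr), expSum_diagonal_mul b hqr hq hr, Nat.cast_mul,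
      Complex.natCast_mul_natCast_cpow]
    ring
  · simp

variable {b : Fin n → ℤ} (hb : ∀ i, b i = 1 ∨ b i = -1)
include hb

lemma seriesDp_odd_prime_mul (hn : Odd n) {s : ℂ} (hs : 1 < s.re) {p : ℕ} (hp : p.Prime)
    (hp2 : p ≠ 2) :
    seriesDp p (Matrix.diagonal b) 0 s *
        ((1 - (p : ℂ) ^ (-(s + 1))) * (1 - (p : ℂ) ^ (-(2 * s + n))))
      = 1 - (p : ℂ) ^ (-(2 * s + n + 1)) := by
  rw [seriesDp_diagonal_mul b hs hp.two_le (coprimePart_prime_pow_odd hb hn hp hp2)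
    (coprimePart_prime_pow_even hb hp hp2), natCast_cpow_neg_add_one hp.ne_zero]
  ring

lemma seriesDp_two_mul (hn : Odd n) {s : ℂ} (hs : 1 < s.re) :
    seriesDp 2 (Matrix.diagonal b) 0 s *
        ((1 - (2 : ℂ) ^ (-(s + 1))) * (1 - (2 : ℂ) ^ (-(2 * s + n))))
      = 1 - (2 : ℂ) ^ (-(2 * s + n)) + dConst b * (2 : ℂ) ^ (-(2 * s + n + 1)) := by
  have h := seriesDp_diagonal_mul (p := 2) b hs le_rfl (coprimePart_two_pow_odd hb hn)
    (c := (dConst b : ℂ) / 2) (fun k => by exact_mod_cast coprimePart_two_pow_even hb hn k)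
  have h2 := natCast_cpow_neg_add_one two_ne_zero (2 * s + n)
  push_cast at h h2
  rw [h, h2]
  ring

lemma seriesD_eq (hn : Odd n) {s : ℂ} (hs : 1 < s.re) :
    seriesD (Matrix.diagonal b) 0 s =
      seriesDp 2 (Matrix.diagonal b) 0 s * twoFactor n s * zetaQuotient n s := by
  have hn0 : (0 : ℝ) ≤ n := n.cast_nonneg
  have hre1 : 1 < (s + 1).re := by simp; linarith
  have hre2 : 1 < (2 * s + n).re := by simp; linarith
  have hre3 : 1 < (2 * s + n + 1).re := by simp; linarith
  have hne : ∀ (p : Nat.Primes) {w : ℂ}, 1 < w.re → 1 - (p : ℂ) ^ (-w) ≠ 0 := fun p w hw =>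
    one_sub_natCast_cpow_neg_ne_zero p.2.two_le (by linarith)
  let P2 : Nat.Primes := ⟨2, Nat.prime_two⟩
  set c := seriesDp 2 (Matrix.diagonal b) 0 s * twoFactor n s with hc
  have hL := (hasProd_seriesDp b hs).mul (riemannZeta_eulerProduct_hasProd hre3)
  -- The discrepancy at the prime 2 enters as a product with a single nontrivial factor `c`, so that
  -- both sides can be compared prime by prime.
  have hR := ((riemannZeta_eulerProduct_hasProd hre1).mul
    (riemannZeta_eulerProduct_hasProd hre2)).mul
    (hasProd_single (f := fun p : Nat.Primes => if p = P2 then c else 1) P2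
      (fun p hp => if_neg hp))
  have heq : ∀ p : Nat.Primes, seriesDp p (Matrix.diagonal b) 0 s
        * (1 - (p : ℂ) ^ (-(2 * s + n + 1)))⁻¹
      = (1 - (p : ℂ) ^ (-(s + 1)))⁻¹ * (1 - (p : ℂ) ^ (-(2 * s + n)))⁻¹
        * (if p = P2 then c else 1) := by
    intro p
    have h1 := hne p hre1
    have h2 := hne p hre2
    have h3 := hne p hre3
    split_ifs with hp
    · subst hp
      simp only [P2, Nat.cast_ofNat] at h1 h2 h3 ⊢
      rw [hc, twoFactor]
      field_simp
    · have h := seriesDp_odd_prime_mul hb hn hs p.2 (fun h => hp (Subtype.ext h))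
      field_simp
      linear_combination h
  have := (hR.congr_fun heq).unique hL
  have hz := riemannZeta_ne_zero_of_one_lt_re hre3
  rw [if_pos rfl] at this
  rw [zetaQuotient, ← mul_div_assoc, eq_div_iff hz]
  linear_combination -this

end EulerFactors

/-! ### Meromorphic continuation and the bound -/

section Continuation

open Filter Topology

lemma analyticAt_riemannZeta {s : ℂ} (hs : s ≠ 1) : AnalyticAt ℂ riemannZeta s := by
  refine DifferentiableOn.analyticAt (s := {1}ᶜ)
    (fun z hz => (differentiableAt_riemannZeta hz).differentiableWithinAt) ?_
  exact isOpen_compl_singleton.mem_nhds hs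

lemma meromorphicAt_riemannZeta (s : ℂ) : MeromorphicAt riemannZeta s := by
  rcases ne_or_eq s 1 with hs | rfl
  · exact (analyticAt_riemannZeta hs).meromorphicAt
  -- Near the pole, `(z - 1) ζ(z)` extends analytically with value 1, the residue.
  let g : ℂ → ℂ := Function.update (fun z => (z - 1) * riemannZeta z) 1 1
  have hg : ∀ z : ℂ, z ≠ 1 → g z = (z - 1) * riemannZeta z := fun z hz =>
    Function.update_of_ne hz _ _
  have hgan : AnalyticAt ℂ g 1 := by
    refine Complex.analyticAt_of_differentiable_on_punctured_nhds_of_continuousAt ?_ ?_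
    · filter_upwards [self_mem_nhdsWithin] with z hz
      refine DifferentiableAt.congr_of_eventuallyEq
        ((differentiableAt_id.sub_const 1).mul (differentiableAt_riemannZeta hz)) ?_
      filter_upwards [isOpen_compl_singleton.mem_nhds hz] with w hw
      exact hg w hw
    · rw [continuousAt_update_same]
      exact riemannZeta_residue_one
  refine (hgan.meromorphicAt.mul
    ((analyticAt_id.sub analyticAt_const).meromorphicAt.inv (x := 1))).congr
      (f := fun z => g z * (id z - 1)⁻¹) ?_
  filter_upwards [self_mem_nhdsWithin] with z hz
  have : z - 1 ≠ 0 := sub_ne_zero.2 hz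
  rw [hg z hz]
  simp only [id]
  field_simp

/-- Passing to normal form changes `g` only on a discrete set, and nowhere that `g` is already
analytic. -/
lemma exists_isMeromorphicContinuation {f g : ℂ → ℂ} {σ₀ : ℝ} (hg : MeromorphicOn g Set.univ)
    (han : ∀ s : ℂ, σ₀ < s.re → AnalyticAt ℂ g s) (heq : ∀ s : ℂ, σ₀ < s.re → g s = f s) :
    ∃ F, IsMeromorphicContinuation f σ₀ F ∧ ∀ᶠ s in codiscrete ℂ, F s = g s := by
  refine ⟨toMeromorphicNFOn g Set.univ, ⟨meromorphicNFOn_toMeromorphicNFOn g Set.univ, ?_⟩, ?_⟩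
  · intro s hs
    rw [toMeromorphicNFOn_eq_toMeromorphicNFAt hg (Set.mem_univ s),
      toMeromorphicNFAt_eq_self.2 (han s hs).meromorphicNFAt, heq s hs]
  · filter_upwards [toMeromorphicNFOn_eqOn_codiscrete hg] with s hs
    exact hs.symm

lemma analyticAt_two_cpow {f : ℂ → ℂ} {s : ℂ} (hf : AnalyticAt ℂ f s) :
    AnalyticAt ℂ (fun s => (2 : ℂ) ^ f s) s :=
  analyticAt_const.cpow hf (by simp)

lemma eventually_one_sub_two_cpow_neg_ne_zero {f : ℂ → ℂ} (hf : ∀ s, AnalyticAt ℂ f s)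
    {s₀ : ℂ} (h₀ : 0 < (f s₀).re) : ∀ᶠ s in codiscrete ℂ, 1 - (2 : ℂ) ^ (-f s) ≠ 0 := by
  have h : AnalyticOnNhd ℂ (fun s => 1 - (2 : ℂ) ^ (-f s)) Set.univ := fun s _ =>
    analyticAt_const.sub (analyticAt_two_cpow (hf s).neg)
  exact h.preimage_zero_mem_codiscrete (x := s₀)
    (by exact_mod_cast one_sub_natCast_cpow_neg_ne_zero le_rfl h₀)

/-- The closed form `(1 - 2^{-(2s+n)} + d 2^{-(2s+n+1)}) / (1 - 2^{-(2s+n+1)})`. -/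
noncomputable def twoAdicQuotient (n : ℕ) (d : ℂ) (s : ℂ) : ℂ :=
  (1 - (2 : ℂ) ^ (-(2 * s + n)) + d * (2 : ℂ) ^ (-(2 * s + n + 1))) /
    (1 - (2 : ℂ) ^ (-(2 * s + n + 1)))

/-- The closed form of the Euler factor at `2`. -/
noncomputable def twoAdicFactor (n : ℕ) (d : ℂ) (s : ℂ) : ℂ :=
  (1 - (2 : ℂ) ^ (-(2 * s + n)) + d * (2 : ℂ) ^ (-(2 * s + n + 1))) /
    ((1 - (2 : ℂ) ^ (-(s + 1))) * (1 - (2 : ℂ) ^ (-(2 * s + n))))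

lemma analyticAt_two_mul_add (n : ℕ) (s : ℂ) : AnalyticAt ℂ (fun s : ℂ => 2 * s + n) s :=
  (analyticAt_const.mul analyticAt_id).add analyticAt_const

lemma analyticAt_twoAdic_numerator (n : ℕ) (d s : ℂ) : AnalyticAt ℂ (fun s : ℂ =>
    1 - (2 : ℂ) ^ (-(2 * s + n)) + d * (2 : ℂ) ^ (-(2 * s + n + 1))) s :=
  (analyticAt_const.sub (analyticAt_two_cpow (analyticAt_two_mul_add n s).neg)).add
    (analyticAt_const.mul
      (analyticAt_two_cpow ((analyticAt_two_mul_add n s).add analyticAt_const).neg))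

lemma analyticAt_twoAdicQuotient_denominator (n : ℕ) (s : ℂ) :
    AnalyticAt ℂ (fun s : ℂ => 1 - (2 : ℂ) ^ (-(2 * s + n + 1))) s :=
  analyticAt_const.sub
    (analyticAt_two_cpow ((analyticAt_two_mul_add n s).add analyticAt_const).neg)

lemma analyticAt_twoAdicFactor_denominator (n : ℕ) (s : ℂ) :
    AnalyticAt ℂ (fun s : ℂ => (1 - (2 : ℂ) ^ (-(s + 1))) * (1 - (2 : ℂ) ^ (-(2 * s + n)))) s :=
  (analyticAt_const.sub (analyticAt_two_cpow (analyticAt_id.add analyticAt_const).neg)).mul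
    (analyticAt_const.sub (analyticAt_two_cpow (analyticAt_two_mul_add n s).neg))

lemma one_sub_two_cpow_neg_ne_zero {w : ℂ} (hw : 0 < w.re) : 1 - (2 : ℂ) ^ (-w) ≠ 0 := by
  exact_mod_cast one_sub_natCast_cpow_neg_ne_zero (p := 2) le_rfl hw

lemma analyticAt_twoAdicQuotient (n : ℕ) (d : ℂ) {s : ℂ} (hs : -(n : ℝ) / 2 < s.re) :
    AnalyticAt ℂ (twoAdicQuotient n d) s :=
  (analyticAt_twoAdic_numerator n d s).div (analyticAt_twoAdicQuotient_denominator n s)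
    (one_sub_two_cpow_neg_ne_zero (by simp; linarith))

lemma analyticAt_twoAdicFactor (n : ℕ) (d : ℂ) {s : ℂ} (hs : 0 < s.re) :
    AnalyticAt ℂ (twoAdicFactor n d) s :=
  (analyticAt_twoAdic_numerator n d s).div (analyticAt_twoAdicFactor_denominator n s)
    (mul_ne_zero (one_sub_two_cpow_neg_ne_zero (by simp; linarith))
      (one_sub_two_cpow_neg_ne_zero (by simp; positivity)))

lemma twoAdicFactor_mul_twoFactor {n : ℕ} (d : ℂ) {s : ℂ}
    (h1 : 1 - (2 : ℂ) ^ (-(s + 1)) ≠ 0) (h2 : 1 - (2 : ℂ) ^ (-(2 * s + n)) ≠ 0) :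
    twoAdicFactor n d s * twoFactor n s = twoAdicQuotient n d s := by
  rw [twoAdicFactor, twoFactor, twoAdicQuotient, div_mul_div_comm, mul_comm,
    mul_div_mul_left _ _ (mul_ne_zero h1 h2)]

/-- On this half plane `|2^(-(2s+n))| < 1`, so the denominator stays at least `1/2` in absolute
value. -/
lemma norm_twoAdicQuotient_le (n : ℕ) (d : ℂ) {s : ℂ} (hs : -(n : ℝ) / 2 < s.re) :
    ‖twoAdicQuotient n d s‖ ≤ 2 * (2 + ‖d‖) := by
  have hre : 0 < (2 * s + n).re := by simp; linarith
  have hX : ‖(2 : ℂ) ^ (-(2 * s + n))‖ < 1 := by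
    exact_mod_cast norm_natCast_cpow_neg_lt_one (p := 2) le_rfl hre
  have hY : ‖(2 : ℂ) ^ (-(2 * s + n + 1))‖ ≤ 1 / 2 := by
    have h := natCast_cpow_neg_add_one two_ne_zero (2 * s + n)
    push_cast at h
    rw [h, norm_div, Complex.norm_ofNat]
    linarith
  have hden : 1 / 2 ≤ ‖1 - (2 : ℂ) ^ (-(2 * s + n + 1))‖ := by
    have := norm_sub_norm_le (1 : ℂ) ((2 : ℂ) ^ (-(2 * s + n + 1)))
    rw [norm_one] at this
    linarith
  have hnum : ‖1 - (2 : ℂ) ^ (-(2 * s + n)) + d * (2 : ℂ) ^ (-(2 * s + n + 1))‖ ≤ 2 + ‖d‖ := by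
    refine (norm_add_le _ _).trans (add_le_add ?_ ?_)
    · refine (norm_sub_le _ _).trans ?_
      rw [norm_one]; linarith
    · rw [norm_mul]
      exact mul_le_of_le_one_right (norm_nonneg _) (by linarith)
  rw [twoAdicQuotient, norm_div, div_le_iff₀ (by linarith)]
  nlinarith [norm_nonneg d]

lemma meromorphicAt_zetaQuotient (n : ℕ) (s : ℂ) : MeromorphicAt (zetaQuotient n) s :=
  (((meromorphicAt_riemannZeta _).comp_analyticAt (g := fun s => s + 1)
    (analyticAt_id.add analyticAt_const)).mul
    ((meromorphicAt_riemannZeta _).comp_analyticAt (analyticAt_two_mul_add n s))).div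
    ((meromorphicAt_riemannZeta _).comp_analyticAt (g := fun s : ℂ => 2 * s + n + 1)
      ((analyticAt_two_mul_add n s).add analyticAt_const))

lemma analyticAt_zetaQuotient (n : ℕ) {s : ℂ} (hs : 1 < s.re) :
    AnalyticAt ℂ (zetaQuotient n) s := by
  have hn0 : (0 : ℝ) ≤ n := n.cast_nonneg
  have hne : ∀ {w : ℂ}, 1 < w.re → w ≠ 1 := fun hw h => by simp [h] at hw
  have h3 : 1 < (2 * s + n + 1).re := by simp; linarith
  exact (((analyticAt_riemannZeta (hne (by simp; linarith))).fun_comp (g := riemannZeta)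
    (f := fun s => s + 1) (analyticAt_id.add analyticAt_const)).mul
    ((analyticAt_riemannZeta (hne (by simp; linarith))).fun_comp (g := riemannZeta)
      (analyticAt_two_mul_add n s))).div
    ((analyticAt_riemannZeta (hne h3)).fun_comp (g := riemannZeta) (f := fun s => 2 * s + n + 1)
      ((analyticAt_two_mul_add n s).add analyticAt_const))
    (riemannZeta_ne_zero_of_one_lt_re h3)

lemma norm_dConst {n : ℕ} (b : Fin n → ℤ) : ‖(dConst b : ℂ)‖ = 2 ^ ((n - 1) / 2) := by
  simp only [dConst]
  split_ifs <;> simp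

end Continuation

theorem theorem4p1 (n : ℕ) (hn : Odd n) :
    ∃ C : ℝ → ℝ, ∀ b : Fin n → ℤ, (∀ i, b i = 1 ∨ b i = -1) →
      -- absolute convergence and the identity of series for `Re s > 1`
      (∀ s : ℂ, 1 < s.re →
        LSeriesSummable (expSum (Matrix.diagonal b) 0) (s + n + 1) ∧
        Summable (localTerm 2 (Matrix.diagonal b) 0 s) ∧
        seriesD (Matrix.diagonal b) 0 s =
          seriesDp 2 (Matrix.diagonal b) 0 s * twoFactor n s * zetaQuotient n s) ∧
      -- the continuations, and the identity between them as meromorphic functions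
      ∃ D D₂ E : ℂ → ℂ,
        IsMeromorphicContinuation (seriesD (Matrix.diagonal b) 0) 1 D ∧
        IsMeromorphicContinuation (seriesDp 2 (Matrix.diagonal b) 0) 1 D₂ ∧
        (∀ᶠ s in Filter.codiscrete ℂ, D s = D₂ s * twoFactor n s * zetaQuotient n s) ∧
        -- `E` is the function `D₂ * twoFactor`, its removable singularities removed
        AnalyticOnNhd ℂ E {s : ℂ | -(n : ℝ) / 2 < s.re} ∧
        (∀ᶠ s in Filter.codiscreteWithin {s : ℂ | -(n : ℝ) / 2 < s.re},
          D₂ s * twoFactor n s = E s) ∧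
        (∀ s : ℂ, -(n : ℝ) / 2 < s.re →
          E s = (1 - (2 : ℂ) ^ (-(2 * s + n)) + dConst b * (2 : ℂ) ^ (-(2 * s + n + 1))) /
            (1 - (2 : ℂ) ^ (-(2 * s + n + 1)))) ∧
        (∀ ε : ℝ, 0 < ε → ∀ s : ℂ, -(n : ℝ) / 2 + ε ≤ s.re → ‖E s‖ ≤ C ε) := by
  -- The bound is uniform up to the edge of the half plane, so it does not involve `ε`; and `|d|` is
  -- the same for all sign vectors, so it can be fixed before `b`.
  refine ⟨fun _ => 2 * (2 + 2 ^ ((n - 1) / 2)), fun b hb => ?_⟩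
  have hn0 : (0 : ℝ) ≤ n := n.cast_nonneg
  have hne1 : ∀ s : ℂ, 1 < s.re → 1 - (2 : ℂ) ^ (-(s + 1)) ≠ 0 := fun s hs =>
    one_sub_two_cpow_neg_ne_zero (by simp; linarith)
  have hne2 : ∀ s : ℂ, 1 < s.re → 1 - (2 : ℂ) ^ (-(2 * s + n)) ≠ 0 := fun s hs =>
    one_sub_two_cpow_neg_ne_zero (by simp; linarith)
  have hfac : ∀ s : ℂ, 1 < s.re →
      twoAdicFactor n (dConst b) s = seriesDp 2 (Matrix.diagonal b) 0 s := fun s hs => by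
    rw [twoAdicFactor, div_eq_iff (mul_ne_zero (hne1 s hs) (hne2 s hs)),
      seriesDp_two_mul hb hn hs]
  have hser : ∀ s : ℂ, 1 < s.re →
      twoAdicQuotient n (dConst b) s * zetaQuotient n s
        = seriesD (Matrix.diagonal b) 0 s := fun s hs => by
    rw [seriesD_eq hb hn hs, ← hfac s hs,
      twoAdicFactor_mul_twoFactor _ (hne1 s hs) (hne2 s hs)]
  refine ⟨fun s hs => ⟨LSeriesSummable_expSum_diagonal b hs,
    summable_localTerm_diagonal b hs le_rfl, seriesD_eq hb hn hs⟩, ?_⟩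
  obtain ⟨D, hD, hDeq⟩ := exists_isMeromorphicContinuation (σ₀ := 1)
    (f := seriesD (Matrix.diagonal b) 0)
    (g := fun s => twoAdicQuotient n (dConst b) s * zetaQuotient n s)
    (fun s _ => ((analyticAt_twoAdic_numerator n _ s).meromorphicAt.div
      (analyticAt_twoAdicQuotient_denominator n s).meromorphicAt).mul
      (meromorphicAt_zetaQuotient n s))
    (fun s hs => (analyticAt_twoAdicQuotient n _ (by linarith)).mul
      (analyticAt_zetaQuotient n hs)) hser
  obtain ⟨D₂, hD₂, hD₂eq⟩ := exists_isMeromorphicContinuation (σ₀ := 1)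
    (f := seriesDp 2 (Matrix.diagonal b) 0) (g := twoAdicFactor n (dConst b))
    (fun s _ => (analyticAt_twoAdic_numerator n _ s).meromorphicAt.div
      (analyticAt_twoAdicFactor_denominator n s).meromorphicAt)
    (fun s hs => analyticAt_twoAdicFactor n _ (by linarith)) hfac
  -- The cancelled factors `1 - 2^(-(s+1))` and `1 - 2^(-(2s+n))` do have zeros, but only on a
  -- discrete set.
  have hprod : ∀ᶠ s in Filter.codiscrete ℂ,
      D₂ s * twoFactor n s = twoAdicQuotient n (dConst b) s := by
    filter_upwards [hD₂eq,
      eventually_one_sub_two_cpow_neg_ne_zero (f := fun s => s + 1) (s₀ := 1)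
        (fun s => analyticAt_id.add analyticAt_const) (by simp),
      eventually_one_sub_two_cpow_neg_ne_zero (s₀ := 1) (analyticAt_two_mul_add n)
        (by simp; positivity)] with s h h1 h2
    rw [h, twoAdicFactor_mul_twoFactor _ h1 h2]
  -- `E` is taken to be the closed form itself, so its formula holds by definition.
  refine ⟨D, D₂, twoAdicQuotient n (dConst b), hD, hD₂, ?_,
    fun s hs => analyticAt_twoAdicQuotient n _ hs,
    Filter.codiscreteWithin_mono (Set.subset_univ _) hprod, fun s _ => rfl, fun ε hε s hs => ?_⟩
  · filter_upwards [hDeq, hprod] with s h1 h2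
    rw [h1, h2]
  · rw [← norm_dConst b]
    exact norm_twoAdicQuotient_le n _ (by linarith)
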